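/- Let $K \subset L$ be commutative fields such that every element of $L$ that is algebraic over $K$ is separable over $K$. For a subset $S \subset L$, write $\langle S\rangle$ for the $K$-subspace of $L$ spanned by $S$; for subsets $S_1, S_2 \subset L$, write $S_1S_2 = \{s_1s_2 \mid s_1 \in S_1,\ s_2 \in S_2\}$ and $S_1^2 = S_1S_1$; and for $X \subset L$ write $X_*^{-1} = \{x^{-1} \mid x \in X \setminus \{0\}\}$. Let $A, B$ be nonzero finite-dimensional $K$-subspaces of $L$. Then either $$\langle A B B_*^{-1} B\rangle = \langle AB\rangle \quad\text{or}\quad \dim_K \langle AB^2\rangle \ge \dim_K A + \dim_K B.$$ -/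

import Mathlib

open scoped Pointwise

/-! ### Atoms and subspace products inside one field. -/

section AtomMethod

variable {K M : Type*} [Field K] [Field M] [Algebra K M]

/-! Scale `B` so that `1 ∈ B`, and let `M = K(B)`. If `A * B` is an `M`-space, the quotients `b / d`
of elements of `B` preserve it: first alternative. Otherwise some `M`-linear `f : L → M` sends `A`
to a nonzero `X` with `X * B ≠ M` (`exists_linearMap_isAdmissible`), and a bound in `M` lifts by
rank-nullity. In `M`, an atom containing `1` is a subfield; it cannot contain the generating space
`B`, so each multiplication by `B` adds at least `dim B / 2` while the product is proper. Two
multiplications give `dim B`; if the second fills `M`, duality suffices. -/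

/-- `X` is a nonzero finitely generated subspace whose product with `B` is proper. -/
structure IsAdmissible (B X : Submodule K M) : Prop where
  fg : X.FG
  ne_bot : X ≠ ⊥
  mul_ne_top : X * B ≠ ⊤

/-- An atom of `B`: an admissible `F` minimizing `dim (X * B) - dim X` with minimum `κ`, and having
minimal dimension among the minimizers. -/
structure IsMulAtom (B : Submodule K M) (κ : ℕ) (F : Submodule K M) : Prop
    extends IsAdmissible B F where
  finrank_mul : Module.finrank K (F * B : Submodule K M) = Module.finrank K F + κ
  le_finrank_mul : ∀ X : Submodule K M, IsAdmissible B X →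
    Module.finrank K X + κ ≤ Module.finrank K (X * B : Submodule K M)
  finrank_le : ∀ X : Submodule K M, IsAdmissible B X →
    Module.finrank K (X * B : Submodule K M) = Module.finrank K X + κ →
      Module.finrank K F ≤ Module.finrank K X

lemma Submodule.le_mul_of_one_mem {B : Submodule K M} (h1 : (1 : M) ∈ B) (X : Submodule K M) :
    X ≤ X * B := fun x hx => by simpa using Submodule.mul_mem_mul hx h1

lemma Submodule.finrank_span_singleton_mul {c : M} (hc : c ≠ 0) (X : Submodule K M) :
    Module.finrank K (Submodule.span K {c} * X : Submodule K M) = Module.finrank K X := by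
  have h : Submodule.span K {c} * X = X.map (LinearMap.mulLeft K c) := by
    ext y
    simp [Submodule.mem_span_singleton_mul]
  rw [h]
  exact (Submodule.equivMapOfInjective _ (mul_right_injective₀ hc) X).finrank_eq.symm

lemma Submodule.span_singleton_mul_span_singleton_inv_mul {c : M} (hc : c ≠ 0)
    (X : Submodule K M) :
    Submodule.span K {c} * (Submodule.span K {c⁻¹} * X) = X := by
  rw [← mul_assoc, Submodule.span_mul_span, Set.singleton_mul_singleton, mul_inv_cancel₀ hc,
    ← Submodule.one_eq_span, one_mul]

lemma IsAdmissible.span_singleton_mul {B X : Submodule K M} (h : IsAdmissible B X) {c : M}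
    (hc : c ≠ 0) : IsAdmissible B (Submodule.span K {c} * X) := by
  have key : ∀ Y : Submodule K M, Submodule.span K {c⁻¹} * (Submodule.span K {c} * Y) = Y := by
    intro Y
    simpa using Submodule.span_singleton_mul_span_singleton_inv_mul (inv_ne_zero hc) Y
  refine ⟨(Submodule.fg_span_singleton c).mul h.fg, fun h0 => h.ne_bot ?_,
    fun h0 => h.mul_ne_top ?_⟩
  · rw [← key X, h0, Submodule.mul_bot]
  · rw [eq_top_iff]
    intro x _
    rw [← key (X * B), ← mul_assoc (Submodule.span K {c}), h0, Submodule.mem_span_singleton_mul]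
    exact ⟨c * x, trivial, by field_simp⟩

lemma IsMulAtom.span_singleton_mul {B F : Submodule K M} {κ : ℕ} (h : IsMulAtom B κ F) {c : M}
    (hc : c ≠ 0) : IsMulAtom B κ (Submodule.span K {c} * F) where
  toIsAdmissible := h.toIsAdmissible.span_singleton_mul hc
  finrank_mul := by
    rw [mul_assoc, Submodule.finrank_span_singleton_mul hc,
      Submodule.finrank_span_singleton_mul hc, h.finrank_mul]
  le_finrank_mul := h.le_finrank_mul
  finrank_le := by
    rw [Submodule.finrank_span_singleton_mul hc]
    exact h.finrank_le

lemma exists_isMulAtom {B X : Submodule K M} (hB : B.FG) (h1 : (1 : M) ∈ B)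
    (hX : IsAdmissible B X) : ∃ κ F, IsMulAtom B κ F := by
  classical
  -- The truncated subtraction is exact: `1 ∈ B` gives `Y ≤ Y * B`.
  let δ : Submodule K M → ℕ := fun Y =>
    Module.finrank K (Y * B : Submodule K M) - Module.finrank K Y
  have hδ : ∀ Y, IsAdmissible B Y →
      Module.finrank K (Y * B : Submodule K M) = Module.finrank K Y + δ Y := by
    intro Y hY
    have : FiniteDimensional K (Y * B : Submodule K M) :=
      Submodule.fg_iff_finiteDimensional _ |>.1 (hY.fg.mul hB)
    have := Submodule.finrank_mono (Submodule.le_mul_of_one_mem h1 Y)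
    simp only [δ]
    omega
  have hP : ∃ k, ∃ Y, IsAdmissible B Y ∧ δ Y = k := ⟨_, X, hX, rfl⟩
  obtain ⟨Y, hY, hYk⟩ := Nat.find_spec hP
  have hQ : ∃ n, ∃ Y, (IsAdmissible B Y ∧ δ Y = Nat.find hP) ∧ Module.finrank K Y = n :=
    ⟨_, Y, ⟨hY, hYk⟩, rfl⟩
  obtain ⟨F, ⟨hF, hFk⟩, hFn⟩ := Nat.find_spec hQ
  refine ⟨Nat.find hP, F, hF, ?_, fun Z hZ => ?_, fun Z hZ hZk => ?_⟩
  · rw [hδ F hF, hFk]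
  · rw [hδ Z hZ]
    exact Nat.add_le_add_left (Nat.find_min' hP ⟨Z, hZ, rfl⟩) _
  · rw [hFn]
    refine Nat.find_min' hQ ⟨Z, ⟨hZ, ?_⟩, rfl⟩
    have := hδ Z hZ
    omega

/-- The form `(x, y) ↦ τ (x * y)`. -/
noncomputable def mulForm (τ : M →ₗ[K] K) : LinearMap.BilinForm K M :=
  (LinearMap.mul K M).compr₂ τ

@[simp] lemma mulForm_apply (τ : M →ₗ[K] K) (x y : M) : mulForm τ x y = τ (x * y) := rfl

lemma mulForm_nondegenerate {τ : M →ₗ[K] K} (hτ : τ ≠ 0) : (mulForm τ).Nondegenerate := by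
  have key : ∀ x, (∀ y, τ (x * y) = 0) → x = 0 := by
    intro x hx
    by_contra h0
    refine hτ (LinearMap.ext fun z => ?_)
    simpa [mul_inv_cancel_left₀ h0] using hx (x⁻¹ * z)
  exact ⟨fun x hx => key x hx, fun x hx => key x fun y => by rw [mul_comm]; exact hx y⟩

lemma Submodule.exists_linearMap_ne_zero_of_ne_top {Y : Submodule K M} (hY : Y ≠ ⊤) :
    ∃ τ : M →ₗ[K] K, τ ≠ 0 ∧ ∀ y ∈ Y, τ y = 0 := by
  obtain ⟨v, hv⟩ : ∃ v, v ∉ Y := by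
    by_contra! h
    exact hY (eq_top_iff.2 fun x _ => h x)
  obtain ⟨τ, hτ, h⟩ := Submodule.exists_le_ker_of_notMem hv
  exact ⟨τ, fun h0 => hτ (by simp [h0]), fun y hy => h hy⟩

/-- If `X * B` is proper then `dim X + dim B ≤ dim M`. -/
lemma finrank_add_finrank_le_of_mul_ne_top [FiniteDimensional K M] {B X : Submodule K M}
    (h : X * B ≠ ⊤) : Module.finrank K X + Module.finrank K B ≤ Module.finrank K M := by
  obtain ⟨τ, hτ, hτX⟩ := Submodule.exists_linearMap_ne_zero_of_ne_top h
  have h1 := LinearMap.BilinForm.finrank_orthogonal (mulForm_nondegenerate hτ) B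
  have h2 : X ≤ (mulForm τ).orthogonal B := by
    intro x hx
    rw [LinearMap.BilinForm.mem_orthogonal_iff]
    intro b hb
    rw [mulForm_apply, mul_comm]
    exact hτX _ (Submodule.mul_mem_mul hx hb)
  have h3 := Submodule.finrank_mono h2
  have h4 := Submodule.finrank_le B
  omega

/-- Duality: the orthogonal `D` of `F * B` satisfies `D * B ≤ Fᗮ`, so `D` attains the minimum `κ`
too. Hence `dim F ≤ dim D = dim M - dim F - κ`. -/
lemma IsMulAtom.two_mul_finrank_add_le [FiniteDimensional K M] {B F : Submodule K M} {κ : ℕ}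
    (h : IsMulAtom B κ F) : 2 * Module.finrank K F + κ ≤ Module.finrank K M := by
  obtain ⟨τ, hτ, hτX⟩ := Submodule.exists_linearMap_ne_zero_of_ne_top h.mul_ne_top
  have hnd := mulForm_nondegenerate hτ
  set D := (mulForm τ).orthogonal (F * B)
  have hD : Module.finrank K D = _ := LinearMap.BilinForm.finrank_orthogonal hnd (F * B)
  have hFo := LinearMap.BilinForm.finrank_orthogonal hnd F
  have hDB : D * B ≤ (mulForm τ).orthogonal F := by
    rw [Submodule.mul_le]
    intro d hd b hb
    rw [LinearMap.BilinForm.mem_orthogonal_iff] at hd ⊢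
    intro f hf
    have := hd (f * b) (Submodule.mul_mem_mul hf hb)
    simpa [mul_assoc, mul_comm d b] using this
  have hDB' := Submodule.finrank_mono hDB
  have hlt := Submodule.finrank_lt h.mul_ne_top
  have hFpos : 0 < Module.finrank K F := by
    rw [Module.finrank_pos_iff, Submodule.nontrivial_iff_ne_bot]
    exact h.ne_bot
  have hFB := h.finrank_mul
  have hadm : IsAdmissible B D := by
    refine ⟨IsNoetherian.noetherian D, fun h0 => ?_, fun h0 => ?_⟩
    · rw [h0, finrank_bot] at hD
      omega
    · rw [h0, finrank_top] at hDB'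
      omega
  have h1 := h.le_finrank_mul D hadm
  have h2 := h.finrank_le D hadm (by omega)
  omega

/-- A smaller nonzero intersection grows by more than `κ`, so by submodularity `F ⊔ G` grows by less
than `κ`. This contradicts minimality, or, if `(F ⊔ G) * B` is everything, the bound `2 * dim F + κ
≤ dim M`. -/
lemma IsMulAtom.le_of_inf_ne_bot {B F G : Submodule K M} {κ : ℕ} (hB : B.FG)
    (hF : IsMulAtom B κ F) (hG : IsMulAtom B κ G) (h : F ⊓ G ≠ ⊥) : F ≤ G := by
  by_contra hle
  have hlt : F ⊓ G < F := inf_le_left.lt_of_ne fun h0 => hle (inf_eq_left.1 h0)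
  have iF : FiniteDimensional K F := (Submodule.fg_iff_finiteDimensional _).1 hF.fg
  have iG : FiniteDimensional K G := (Submodule.fg_iff_finiteDimensional _).1 hG.fg
  have iFB : FiniteDimensional K (F * B : Submodule K M) :=
    (Submodule.fg_iff_finiteDimensional _).1 (hF.fg.mul hB)
  have iGB : FiniteDimensional K (G * B : Submodule K M) :=
    (Submodule.fg_iff_finiteDimensional _).1 (hG.fg.mul hB)
  have iI : FiniteDimensional K (F ⊓ G : Submodule K M) := Submodule.finiteDimensional_inf_left _ _
  have hFG : Module.finrank K F = Module.finrank K G :=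
    le_antisymm (hF.finrank_le G hG.toIsAdmissible hG.finrank_mul)
      (hG.finrank_le F hF.toIsAdmissible hF.finrank_mul)
  have hItop : (F ⊓ G) * B ≠ ⊤ := fun h0 =>
    hF.mul_ne_top (top_le_iff.1 (h0 ▸ mul_le_mul_left inf_le_left B))
  have hI : IsAdmissible B (F ⊓ G) := ⟨(Submodule.fg_iff_finiteDimensional _).2 iI, h, hItop⟩
  have e1 := hF.le_finrank_mul _ hI
  have e2 : Module.finrank K ((F ⊓ G) * B : Submodule K M) ≠
      Module.finrank K (F ⊓ G : Submodule K M) + κ := fun h0 =>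
    absurd (hF.finrank_le _ hI h0) (not_le.2 (Submodule.finrank_lt_finrank_of_lt hlt))
  have e3 := Submodule.finrank_sup_add_finrank_inf_eq F G
  have e4 := Submodule.finrank_sup_add_finrank_inf_eq (F * B) (G * B)
  have e5 : Module.finrank K ((F ⊓ G) * B : Submodule K M) ≤
      Module.finrank K (F * B ⊓ G * B : Submodule K M) :=
    Submodule.finrank_mono (le_inf (mul_le_mul_left inf_le_left B)
      (mul_le_mul_left inf_le_right B))
  rw [← Submodule.sup_mul] at e4
  have e6 := hF.finrank_mul
  have e7 := hG.finrank_mul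
  have hIpos : 0 < Module.finrank K (F ⊓ G : Submodule K M) := by
    rw [Module.finrank_pos_iff, Submodule.nontrivial_iff_ne_bot]
    exact h
  by_cases htop : (F ⊔ G) * B = ⊤
  · have : FiniteDimensional K M := by
      refine ⟨?_⟩
      rw [← htop]
      exact (hF.fg.sup hG.fg).mul hB
    rw [htop, finrank_top] at e4
    have e8 := hF.two_mul_finrank_add_le
    omega
  · have e8 := hF.le_finrank_mul (F ⊔ G) ⟨hF.fg.sup hG.fg,
      fun h0 => hF.ne_bot (le_bot_iff.1 (h0 ▸ le_sup_left)), htop⟩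
    omega

/-- An atom containing `1` is a subfield. -/
lemma IsMulAtom.exists_intermediateField {B F : Submodule K M} {κ : ℕ} (hB : B.FG)
    (hF : IsMulAtom B κ F) (h1 : (1 : M) ∈ F) :
    ∃ E : IntermediateField K M, ∀ x, x ∈ E ↔ x ∈ F := by
  have key : ∀ x ∈ F, x ≠ 0 → ∀ y, y ∈ F ↔ x * y ∈ F := by
    intro x hx hx0
    have hat := hF.span_singleton_mul (inv_ne_zero hx0)
    have hone : (1 : M) ∈ Submodule.span K {x⁻¹} * F :=
      Submodule.mem_span_singleton_mul.2 ⟨x, hx, inv_mul_cancel₀ hx0⟩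
    have hne : F ⊓ (Submodule.span K {x⁻¹} * F) ≠ ⊥ := fun h0 => by
      have : (1 : M) ∈ F ⊓ (Submodule.span K {x⁻¹} * F) := ⟨h1, hone⟩
      rw [h0] at this
      exact one_ne_zero ((Submodule.mem_bot K).1 this)
    -- Both atoms contain `1`, so they coincide; `F = x⁻¹F` gives products and inverses.
    have heq : F = Submodule.span K {x⁻¹} * F :=
      le_antisymm (hF.le_of_inf_ne_bot hB hat hne)
        (hat.le_of_inf_ne_bot hB hF (by rwa [inf_comm]))
    intro y
    conv_lhs => rw [heq, Submodule.mem_span_singleton_mul]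
    constructor
    · rintro ⟨z, hz, rfl⟩
      rwa [mul_inv_cancel_left₀ hx0]
    · exact fun h => ⟨_, h, inv_mul_cancel_left₀ hx0 y⟩
  have hmul : ∀ x ∈ F, ∀ y ∈ F, x * y ∈ F := by
    intro x hx y hy
    rcases eq_or_ne x 0 with rfl | hx0
    · simp
    · exact (key x hx hx0 y).1 hy
  refine ⟨(F.toSubalgebra h1 (fun x y hx hy => hmul x hx y hy)).toIntermediateField ?_,
    fun x => Iff.rfl⟩
  intro x hx
  rcases eq_or_ne x 0 with rfl | hx0
  · simp
  · exact (key x hx hx0 _).2 (by rwa [mul_inv_cancel₀ hx0])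

/-- If `B` contains `1` and generates the field `M`, multiplication by `B` enlarges a subspace by at
least half the dimension of `B`, as long as the product is proper. -/
lemma IsAdmissible.two_mul_finrank_add_le {B X : Submodule K M} (hB : B.FG) (h1 : (1 : M) ∈ B)
    (hgen : IntermediateField.adjoin K (B : Set M) = ⊤) (hX : IsAdmissible B X) :
    2 * Module.finrank K X + Module.finrank K B ≤
      2 * Module.finrank K (X * B : Submodule K M) := by
  obtain ⟨κ, F₀, hF₀⟩ := exists_isMulAtom hB h1 hX
  obtain ⟨c, hc, hc0⟩ := Submodule.exists_mem_ne_zero_of_ne_bot hF₀.ne_bot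
  set F := Submodule.span K {c⁻¹} * F₀
  have hF : IsMulAtom B κ F := hF₀.span_singleton_mul (inv_ne_zero hc0)
  have h1F : (1 : M) ∈ F := Submodule.mem_span_singleton_mul.2 ⟨c, hc, inv_mul_cancel₀ hc0⟩
  obtain ⟨E, hE⟩ := hF.exists_intermediateField hB h1F
  obtain ⟨b, hb, hbF⟩ : ∃ b ∈ B, b ∉ F := by
    by_contra! h
    have hEtop : E = ⊤ := by
      rw [← top_le_iff, ← hgen, IntermediateField.adjoin_le_iff]
      exact fun b hb => (hE b).2 (h b hb)
    refine hF.mul_ne_top (top_le_iff.1 fun x _ => Submodule.le_mul_of_one_mem h1 F ?_)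
    rw [← hE, hEtop]
    trivial
  have hb0 : b ≠ 0 := fun h => hbF (h ▸ F.zero_mem)
  set G := Submodule.span K {b} * F
  have hGF : F ⊓ G = ⊥ := by
    rw [eq_bot_iff]
    rintro x ⟨hx, hx'⟩
    obtain ⟨z, hz, rfl⟩ := Submodule.mem_span_singleton_mul.1 hx'
    rw [Submodule.mem_bot]
    by_contra h0
    have hz0 : z ≠ 0 := right_ne_zero_of_mul h0
    refine hbF ((hE b).1 ?_)
    have := E.mul_mem ((hE _).2 hx) (E.inv_mem ((hE _).2 hz))
    rwa [mul_inv_cancel_right₀ hz0] at this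
  have iF : FiniteDimensional K F := (Submodule.fg_iff_finiteDimensional _).1 hF.fg
  have iG : FiniteDimensional K G :=
    (Submodule.fg_iff_finiteDimensional _).1 ((Submodule.fg_span_singleton b).mul hF.fg)
  have iFB : FiniteDimensional K (F * B : Submodule K M) :=
    (Submodule.fg_iff_finiteDimensional _).1 (hF.fg.mul hB)
  have e1 := Submodule.finrank_sup_add_finrank_inf_eq F G
  rw [hGF, finrank_bot, Submodule.finrank_span_singleton_mul hb0] at e1
  have e2 : F ⊔ G ≤ F * B := by
    refine sup_le (Submodule.le_mul_of_one_mem h1 F) ?_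
    rw [mul_comm F B]
    exact mul_le_mul_left (by simpa using hb) F
  have e3 := Submodule.finrank_mono e2
  have e4 : Module.finrank K B ≤ Module.finrank K (F * B : Submodule K M) :=
    Submodule.finrank_mono (by rw [mul_comm]; exact Submodule.le_mul_of_one_mem h1F B)
  have e5 := hF.finrank_mul
  have e6 := hF.le_finrank_mul X hX
  -- `F ⊕ bF ≤ F * B` gives `κ ≥ dim F`, and `B ≤ F * B` gives `dim F + κ ≥ dim B`; hence `2κ ≥ dim
  -- B`.
  omega

lemma IsAdmissible.finrank_add_finrank_le {B X : Submodule K M} (hB : B.FG) (h1 : (1 : M) ∈ B)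
    (hgen : IntermediateField.adjoin K (B : Set M) = ⊤) (hX : IsAdmissible B X) :
    Module.finrank K X + Module.finrank K B ≤
      Module.finrank K (X * B * B : Submodule K M) := by
  by_cases h : X * B * B = ⊤
  · have : FiniteDimensional K M := by
      refine ⟨?_⟩
      rw [← h]
      exact (hX.fg.mul hB).mul hB
    rw [h, finrank_top]
    exact finrank_add_finrank_le_of_mul_ne_top hX.mul_ne_top
  · have h2 : IsAdmissible B (X * B) := ⟨hX.fg.mul hB, fun h0 => hX.ne_bot
      (le_bot_iff.1 (h0 ▸ Submodule.le_mul_of_one_mem h1 X)), h⟩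
    have := hX.two_mul_finrank_add_le hB h1 hgen
    have := h2.two_mul_finrank_add_le hB h1 hgen
    omega

end AtomMethod

/-! ### Passage from `L` to the field generated by `B`. -/

section Extension

variable {K L : Type*} [Field K] [Field L] [Algebra K L]

/-- A functional on `L` factors through any nonzero functional on a finite intermediate field `M`,
by an `M`-linear map. -/
lemma exists_linearMap_comp_eq {M : IntermediateField K L} [FiniteDimensional K M]
    {τ : M →ₗ[K] K} (hτ : τ ≠ 0) (φ : L →ₗ[K] K) :
    ∃ f : L →ₗ[M] M, ∀ x, τ (f x) = φ x := by
  have hinj : Function.Injective (mulForm τ) := by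
    rw [← LinearMap.ker_eq_bot]
    exact LinearMap.BilinForm.Nondegenerate.ker_eq_bot (mulForm_nondegenerate hτ)
  have hsurj : Function.Surjective (mulForm τ) :=
    (LinearMap.injective_iff_surjective_of_finrank_eq_finrank
      (Subspace.dual_finrank_eq (K := K) (V := M)).symm).1 hinj
  -- Nondegeneracy represents the functional `m ↦ φ (m * x)` on `M` by an element of `M`, which
  -- becomes `f x`.
  have hex : ∀ x : L, ∃ c : M, ∀ m : M, τ (c * m) = φ ((m : L) * x) := fun x => by
    obtain ⟨c, hc⟩ := hsurj (φ ∘ₗ (LinearMap.mulRight K x) ∘ₗ M.val.toLinearMap)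
    exact ⟨c, fun m => LinearMap.congr_fun hc m⟩
  choose f hf using hex
  have huniq : ∀ c d : M, (∀ m, τ (c * m) = τ (d * m)) → c = d := fun c d h =>
    hinj (LinearMap.ext h)
  refine ⟨{ toFun := f, map_add' := fun x y => huniq _ _ fun m => ?_,
            map_smul' := fun c x => huniq _ _ fun m => ?_ }, fun x => ?_⟩
  · rw [hf, add_mul, map_add, hf, hf, mul_add, map_add]
  · rw [hf, RingHom.id_apply, smul_eq_mul, mul_assoc, mul_left_comm, hf,
      IntermediateField.smul_def, smul_eq_mul, MulMemClass.coe_mul, mul_left_comm, mul_assoc]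
  · simpa using hf x 1

/-- If `A * B` is not stable under the field `M ⊇ B`, there is an `M`-linear projection to `M` under
which the image of `A` is admissible. -/
lemma exists_linearMap_isAdmissible {M : IntermediateField K L} {A B : Submodule K L}
    {C : Submodule K M} (hC : C.map M.val.toLinearMap = B) (hA : A.FG) (hB : B.FG)
    {m x : L} (hm : m ∈ M) (hx : x ∈ A * B) (hmx : m * x ∉ A * B) :
    ∃ f : L →ₗ[M] M, IsAdmissible C (A.map (f.restrictScalars K)) := by
  have hCfg : C.FG := Submodule.fg_of_fg_map_injective M.val.toLinearMap
    Subtype.val_injective (hC ▸ hB)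
  have hA0 : A ≠ ⊥ := by
    rintro rfl
    rw [Submodule.bot_mul, Submodule.mem_bot] at hx
    exact hmx (by simp [hx])
  have hBM : ∀ b ∈ B, b ∈ M := by
    rw [← hC]
    rintro _ ⟨c, -, rfl⟩
    exact c.2
  by_cases hfin : FiniteDimensional K M
  · obtain ⟨τ, hτ, -⟩ :=
      Submodule.exists_linearMap_ne_zero_of_ne_top (bot_ne_top (α := Submodule K M))
    -- If `f` killed `A`, it would kill `m * x` by `M`-linearity, yet `φ (m * x) ≠ 0`. Properness
    -- holds because `τ` kills the product, as `φ` kills `A * B`.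
    obtain ⟨φ, hφ, hker⟩ := Submodule.exists_le_ker_of_notMem hmx
    obtain ⟨f, hf⟩ := exists_linearMap_comp_eq hτ φ
    refine ⟨f, hA.map _, fun h0 => hφ ?_, fun h0 => hτ ?_⟩
    · have hfA : ∀ a ∈ A, f a = 0 := fun a ha => by
        have : f a ∈ A.map (f.restrictScalars K) := ⟨a, ha, rfl⟩
        rwa [h0, Submodule.mem_bot] at this
      have hfx : f x = 0 := by
        have : A * B ≤ (LinearMap.ker f).restrictScalars K := by
          rw [Submodule.mul_le]
          intro a ha b hb
          have := f.map_smul ⟨b, hBM b hb⟩ a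
          rw [hfA a ha, smul_zero, IntermediateField.smul_def, smul_eq_mul, mul_comm] at this
          exact this
        exact this hx
      have := f.map_smul ⟨m, hm⟩ x
      rw [hfx, smul_zero, IntermediateField.smul_def, smul_eq_mul] at this
      rw [← hf, this, map_zero]
    · have hle : A.map (f.restrictScalars K) * C ≤ LinearMap.ker τ := by
        rw [Submodule.mul_le]
        rintro _ ⟨a, ha, rfl⟩ c hc
        have hcB : (c : L) ∈ B := hC ▸ ⟨c, hc, rfl⟩
        have h1 := hker (Submodule.mul_mem_mul ha hcB)
        have h2 := f.map_smul c a
        rw [IntermediateField.smul_def, smul_eq_mul, smul_eq_mul, mul_comm _ a,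
          mul_comm c] at h2
        rw [LinearMap.mem_ker] at h1 ⊢
        rw [← hf, h2] at h1
        exact h1
      rw [h0, top_le_iff, LinearMap.ker_eq_top] at hle
      exact hle
  -- For infinite `M`, properness is automatic: the product is finite-dimensional.
  · obtain ⟨a, ha, ha0⟩ := Submodule.exists_mem_ne_zero_of_ne_bot hA0
    obtain ⟨f, hf⟩ : ∃ f : Module.Dual M L, f a ≠ 0 := by
      by_contra! h
      exact ha0 ((Module.forall_dual_apply_eq_zero_iff M a).1 h)
    refine ⟨f, hA.map _, fun h0 => hf ?_, fun h0 => hfin ⟨?_⟩⟩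
    · have : f a ∈ A.map (f.restrictScalars K) := ⟨a, ha, rfl⟩
      rwa [h0, Submodule.mem_bot] at this
    · rw [← h0]
      exact (hA.map _).mul hCfg

lemma Submodule.finrank_map_add_finrank_inf_ker {V W : Type*} [AddCommGroup V] [Module K V]
    [AddCommGroup W] [Module K W] (g : V →ₗ[K] W) (X : Submodule K V) [FiniteDimensional K X] :
    Module.finrank K (X.map g) + Module.finrank K (X ⊓ LinearMap.ker g : Submodule K V) =
      Module.finrank K X := by
  rw [← (g.domRestrict X).finrank_range_add_finrank_ker, LinearMap.range_domRestrict,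
    LinearMap.ker_domRestrict]
  congr 1
  rw [← Submodule.map_comap_subtype]
  exact (Submodule.equivSubtypeMap X (Submodule.comap X.subtype (LinearMap.ker g))).finrank_eq.symm

/-- If `1 ∈ B` and `A * B` is not stable under the field generated by `B`, then
`dim A + dim B ≤ dim (A * B * B)`. -/
lemma finrank_add_finrank_le_of_not_stable {A B : Submodule K L} (hA : A.FG) (hB : B.FG)
    (h1 : (1 : L) ∈ B) {m x : L} (hm : m ∈ IntermediateField.adjoin K (B : Set L))
    (hx : x ∈ A * B) (hmx : m * x ∉ A * B) :
    Module.finrank K A + Module.finrank K B ≤ Module.finrank K (A * B * B : Submodule K L) := by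
  set M := IntermediateField.adjoin K (B : Set L)
  set C : Submodule K M := B.comap M.val.toLinearMap
  have hC : C.map M.val.toLinearMap = B := by
    refine Submodule.map_comap_eq_of_le ?_
    intro b hb
    exact ⟨⟨b, IntermediateField.subset_adjoin K _ hb⟩, rfl⟩
  obtain ⟨f, hf⟩ := exists_linearMap_isAdmissible hC hA hB hm hx hmx
  have hCfg : C.FG := Submodule.fg_of_fg_map_injective M.val.toLinearMap
    Subtype.val_injective (hC.symm ▸ hB)
  have hgen : IntermediateField.adjoin K (C : Set M) = ⊤ := by
    apply IntermediateField.lift_injective M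
    have hval : Subtype.val '' (C : Set M) = (B : Set L) :=
      congrArg (fun X : Submodule K L => (X : Set L)) hC
    rw [IntermediateField.lift_adjoin, IntermediateField.lift_top, hval]
  have key := hf.finrank_add_finrank_le hCfg h1 hgen
  have hCB : Module.finrank K C = Module.finrank K B := by
    rw [← hC]
    exact (Submodule.equivMapOfInjective M.val.toLinearMap Subtype.val_injective C).finrank_eq
  set g := f.restrictScalars K
  have iA : FiniteDimensional K A := (Submodule.fg_iff_finiteDimensional _).1 hA
  have iP : FiniteDimensional K (A * B * B : Submodule K L) :=
    (Submodule.fg_iff_finiteDimensional _).1 ((hA.mul hB).mul hB)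
  have hmul : ∀ X : Submodule K L, X.map g * C ≤ (X * B).map g := by
    intro X
    rw [Submodule.mul_le]
    rintro _ ⟨a, ha, rfl⟩ c hc
    refine ⟨a * c, Submodule.mul_mem_mul ha hc, ?_⟩
    have h2 := f.map_smul c a
    rw [IntermediateField.smul_def, smul_eq_mul, smul_eq_mul, mul_comm _ a, mul_comm c] at h2
    exact h2
  have hle : A.map g * C * C ≤ (A * B * B).map g :=
    (mul_le_mul_left (hmul A) C).trans (hmul (A * B))
  have iPg : FiniteDimensional K ((A * B * B).map g) := inferInstance
  have e1 := Submodule.finrank_mono hle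
  have e2 := Submodule.finrank_map_add_finrank_inf_ker g A
  have e3 := Submodule.finrank_map_add_finrank_inf_ker g (A * B * B)
  have iI : FiniteDimensional K (A * B * B ⊓ LinearMap.ker g : Submodule K L) :=
    Submodule.finiteDimensional_inf_left _ _
  -- Since `A ≤ A * B * B`, the kernel part lost from `A` is recovered in the product.
  have e4 : Module.finrank K (A ⊓ LinearMap.ker g : Submodule K L) ≤
      Module.finrank K (A * B * B ⊓ LinearMap.ker g : Submodule K L) :=
    Submodule.finrank_mono (inf_le_inf_right _
      ((Submodule.le_mul_of_one_mem h1 A).trans (Submodule.le_mul_of_one_mem h1 _)))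
  omega

end Extension

/-! ### Normalization and the dichotomy. -/

theorem mainTheorem11 {K L : Type*} [Field K] [Field L] [Algebra K L]
    (hsep : ∀ x : L, IsAlgebraic K x → IsSeparable K x)
    (A B : Submodule K L) [FiniteDimensional K A] [FiniteDimensional K B]
    (hA : A ≠ ⊥) (hB : B ≠ ⊥) :
    Submodule.span K ((A : Set L) * (B : Set L) * ((B : Set L) \ {0})⁻¹ * (B : Set L))
        = Submodule.span K ((A : Set L) * (B : Set L)) ∨
      Module.finrank K A + Module.finrank K B
        ≤ Module.finrank K (Submodule.span K ((A : Set L) * (B : Set L) ^ 2)) := by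
  obtain ⟨c, hc, hc0⟩ := Submodule.exists_mem_ne_zero_of_ne_bot hB
  have hAfg : A.FG := (Submodule.fg_iff_finiteDimensional _).2 inferInstance
  have hBfg : B.FG := (Submodule.fg_iff_finiteDimensional _).2 inferInstance
  have hAB : Submodule.span K ((A : Set L) * (B : Set L)) = A * B := by
    rw [← Submodule.span_mul_span, Submodule.span_eq, Submodule.span_eq]
  have hABB : Submodule.span K ((A : Set L) * (B : Set L) ^ 2) = A * B * B := by
    rw [pow_two, ← Submodule.span_mul_span, ← Submodule.span_mul_span, Submodule.span_eq,
      Submodule.span_eq, mul_assoc]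
  rw [hAB, hABB]
  set S := Submodule.span K {c⁻¹}
  set D := S * B with hD
  have hDfg : D.FG := (Submodule.fg_span_singleton _).mul hBfg
  have hdiv : ∀ b ∈ B, c⁻¹ * b ∈ D := fun b hb => Submodule.mem_span_singleton_mul.2 ⟨b, hb, rfl⟩
  have h1 : (1 : L) ∈ D := by simpa [inv_mul_cancel₀ hc0] using hdiv c hc
  have hBD : Submodule.span K {c} * D = B :=
    Submodule.span_singleton_mul_span_singleton_inv_mul hc0 B
  by_cases hst : ∀ m ∈ IntermediateField.adjoin K (D : Set L), ∀ x ∈ A * D, m * x ∈ A * D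
  · left
    apply le_antisymm
    · rw [Submodule.span_le]
      rintro _ ⟨_, ⟨_, ⟨a, ha, b, hb, rfl⟩, d, ⟨hd, hd0⟩, rfl⟩, e, he, rfl⟩
      have hd0' : d ≠ 0 := fun h => hd0 (by simp [h])
      have hsub := IntermediateField.subset_adjoin K (D : Set L)
      -- Here `d⁻¹ ∈ B`, and this element equals `b * d`: the scaling by `c` cancels.
      have hm : (c⁻¹ * b) * (c⁻¹ * d⁻¹)⁻¹ ∈ IntermediateField.adjoin K (D : Set L) :=
        mul_mem (hsub (hdiv b hb)) (inv_mem (hsub (hdiv _ hd)))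
      have hx := hst _ hm _ (Submodule.mul_mem_mul ha (hdiv e he))
      have hmem := Submodule.mul_mem_mul (Submodule.mem_span_singleton_self (R := K) c) hx
      rw [mul_left_comm, hBD] at hmem
      have heq : c * ((c⁻¹ * b) * (c⁻¹ * d⁻¹)⁻¹ * (a * (c⁻¹ * e))) = a * b * d * e := by
        field_simp
      rwa [heq] at hmem
    · rw [Submodule.mul_le]
      intro a ha b hb
      -- Insert `c⁻¹ * c = 1` after `a * b`.
      refine Submodule.subset_span ⟨_, ⟨_, ⟨a, ha, b, hb, rfl⟩, c⁻¹, ?_, rfl⟩, c, hc, ?_⟩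
      · simpa using ⟨hc, hc0⟩
      · simp [hc0]
  · right
    push Not at hst
    obtain ⟨m, hm, x, hx, hmx⟩ := hst
    have h := finrank_add_finrank_le_of_not_stable hAfg hDfg h1 hm hx hmx
    have e : A * D * D = S * (S * (A * B * B)) := by
      rw [hD]
      ac_rfl
    rwa [e, Submodule.finrank_span_singleton_mul (inv_ne_zero hc0),
      Submodule.finrank_span_singleton_mul (inv_ne_zero hc0),
      Submodule.finrank_span_singleton_mul (inv_ne_zero hc0)] at h
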